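/- Fix $d,N\in\mathbb N$, $\kappa>0$, $\delta>0$ and an integer $m\ge 1$. Let $x=(x_1,\dots,x_N):[0,\infty)\to(\mathbb R^{d})^N$ be a solution of $$\dot x_i=\kappa\sum_{k\in\mathcal N_i(t)}(x_k-x_i),\qquad i=1,\dots,N,$$ where $k\in\mathcal N_i(t)$ if and only if $x_k(t)\in B(x_i(t),\delta)$ and $\#\{l: x_l(t)\in B(x_i(t),\delta)\}>m$; here $B(y,\rho)$ is the open Euclidean ball. Since the right-hand side may jump when a set $\mathcal N_i(t)$ changes, a solution is understood as a continuous $x$ satisfying the integrated equation $x_i(t)=x_i(0)+\int_0^t\kappa\sum_{k\in\mathcal N_i(s)}(x_k(s)-x_i(s))\,ds$ for all $t\ge0$ and all $i$; this includes all smooth and piecewise smooth solutions. A set $\mathcal A\subset\{1,\dots,N\}$ (a cluster) is *isolated* at time $t$ if for all $i\in\mathcal A$ and $j\notin\mathcal A$ neither $i\in\mathcal N_j(t)$ nor $j\in\mathcal N_i(t)$. It is *$r$-densely packed* at time $t$ if $\bigcup_{i\in\mathcal A}B(x_i(t),r/2)$ is connected (and non-empty) and every ball $B(x_i(t),r)$,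 $i\in\mathcal A$, contains more than $m$ of the $N$ agents. Let $\mathcal A\neq\emptyset$ be a cluster, and let $\mathcal Z:=e^{\frac{2m}{3(\#\mathcal A)^3}}$. Then there is $r^*\in(0,\delta)$ satisfying $$\frac{r^*}{\delta}\,\mathcal Z^{\frac{r^*}{\delta}}\le\frac{m}{6\,\#\mathcal A}\,\mathcal Z ,\qquad(1)$$ and every $r^*\in(0,\delta)$ satisfying (1) has the following property: for every solution $x$ and every $t_0\ge 0$ such that $\mathcal A$ is isolated at all times $t\ge t_0$, if $\mathcal A$ is $r$-densely packed at time $t_0$ for some $r\le r^*$, then $\mathcal A$ is $\delta$-densely packed at all times $t\ge t_0$. -/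

import Mathlib

open MeasureTheory

namespace DIProtocol

/-- A point of the `d`-dimensional Euclidean space. -/
abbrev Pos (d : ℕ) : Type := EuclideanSpace ℝ (Fin d)

open Classical in
/-- The agents whose positions lie in the open ball of centre `p i` and radius `ρ`
(the agent `i` itself is counted when `0 < ρ`). -/
noncomputable def agentsInBall {d N : ℕ} (p : Fin N → Pos d) (ρ : ℝ) (i : Fin N) :
    Finset (Fin N) :=
  Finset.univ.filter fun k => p k ∈ Metric.ball (p i) ρ

open Classical in
/-- The neighbour set of agent `i` in the configuration `p`: the agent `k` is a neighbour of `i` iff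
it lies in the open `δ`-ball around `i` and that ball contains more than `m` agents. -/
noncomputable def neighbors {d N : ℕ} (δ : ℝ) (m : ℕ) (p : Fin N → Pos d) (i : Fin N) :
    Finset (Fin N) :=
  Finset.univ.filter fun k => p k ∈ Metric.ball (p i) δ ∧ m < (agentsInBall p δ i).card

/-- The directed edge relation on agents: there is an edge `(i, j)` iff `i` is a neighbour
of `j`. -/
def Edge {d N : ℕ} (δ : ℝ) (m : ℕ) (p : Fin N → Pos d) (i j : Fin N) : Prop :=
  i ∈ neighbors δ m p j

/-- A cluster (any set of agents) is isolated if no edge, in either direction, joins it to an agent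
outside of it. -/
def IsIsolated {d N : ℕ} (δ : ℝ) (m : ℕ) (p : Fin N → Pos d) (A : Finset (Fin N)) : Prop :=
  ∀ i ∈ A, ∀ j ∉ A, ¬ Edge δ m p i j ∧ ¬ Edge δ m p j i

/-- A cluster is `r`-densely packed if the union of the open balls of radius `r / 2` around its
agents is connected, and each open ball of radius `r` around one of its agents contains more than
`m` agents of the ensemble. -/
def IsDenselyPacked {d N : ℕ} (m : ℕ) (r : ℝ) (p : Fin N → Pos d) (A : Finset (Fin N)) : Prop :=
  IsConnected (⋃ i ∈ A, Metric.ball (p i) (r / 2)) ∧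
    ∀ i ∈ A, m < (agentsInBall p r i).card

/-- The right-hand side of the protocol: the velocity of agent `i` in the configuration `p`. -/
noncomputable def velocity {d N : ℕ} (κ δ : ℝ) (m : ℕ) (p : Fin N → Pos d) (i : Fin N) : Pos d :=
  κ • ∑ k ∈ neighbors δ m p i, (p k - p i)

/-- `x` is a solution on `[0, ∞)` of `x_i' = κ ∑_{k ∈ N_i} (x_k - x_i)`. The right-hand side jumps
whenever a neighbour set changes, so the equation is required in integrated form: trajectories are
continuous and `x_i(t) = x_i(0) + ∫_0^t velocity_i`. The integrand is measurable and locally bounded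
along continuous trajectories. Every trajectory that is differentiable and satisfies the equation,
at all times or piecewise, is a solution in this sense. -/
def IsSolution {d N : ℕ} (κ δ : ℝ) (m : ℕ) (x : ℝ → Fin N → Pos d) : Prop :=
  ContinuousOn x (Set.Ici 0) ∧
    ∀ i : Fin N, ∀ t : ℝ, 0 ≤ t →
      x t i = x 0 i + ∫ s in (0 : ℝ)..t, velocity κ δ m (x s) i

/-- The constant `Z = exp (2 m / (3 n ^ 3))` for a cluster of `n` agents. -/
noncomputable def zConst (m n : ℕ) : ℝ :=
  Real.exp (2 * (m : ℝ) / (3 * (n : ℝ) ^ 3))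

/-- The smallness condition `(r / δ) Z ^ (r / δ) ≤ m / (6 n) Z` on the packing radius `r` of a
cluster of `n` agents. -/
def PackingCondition (δ : ℝ) (m n : ℕ) (r : ℝ) : Prop :=
  r / δ * zConst m n ^ (r / δ) ≤ (m : ℝ) / (6 * (n : ℝ)) * zConst m n

end DIProtocol

/-! Let `n` be the size of the cluster. Isolation forces the more than `m` agents near each member
into the cluster, so its `r`-proximity graph is connected with closed neighbourhoods of at least `m
+ 1` vertices. Along a geodesic, every third vertex has a disjoint neighbourhood, which bounds the
graph diameter by `3 n / (m + 1) - 1` and the Euclidean one by `r` times that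
(`IsDenselyPacked.dist_add_le`). Since `Z < 2`, condition (1) gives `3 n r < m δ`, so initially all
members see each other. While they do, each neighbour set is the whole cluster and differences
satisfy `w' = -κ n w`; distances cannot grow, so no first time of violation exists
(`IsSolution.dist_lt`). Diameter below `δ` then yields dense packing. -/

/-- In a connected graph whose closed neighbourhoods have at least `k` elements, distances are at
most `3 n / k - 1`. -/
theorem SimpleGraph.Connected.dist_add_one_mul_le {V : Type*} [Fintype V] {G : SimpleGraph V}
    (hG : G.Connected) {k : ℕ} (hk : ∀ v, k ≤ (Finset.univ.filter fun w => G.dist v w ≤ 1).card)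
    (u v : V) : (G.dist u v + 1) * k ≤ 3 * Fintype.card V := by
  classical
  set L := G.dist u v with hL
  have hlevel : ∀ j ≤ L, ∃ w, G.dist u w = j := by
    intro j hj
    obtain ⟨p, hp⟩ := hG.exists_walk_length_eq_dist u v
    refine ⟨p.getVert j, ?_⟩
    have h1 := SimpleGraph.dist_le (p.take j)
    have h2 := SimpleGraph.dist_le (p.drop j)
    have h3 := hG.dist_triangle (u := u) (v := p.getVert j) (w := v)
    rw [SimpleGraph.Walk.take_length] at h1
    rw [SimpleGraph.Walk.drop_length] at h2
    omega
  -- Distance levels `3j-1, 3j, 3j+1` form block `j`; it contains the closed neighbourhood of any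
  -- vertex at level `3j`.
  have hfiber : ∀ j ∈ Finset.range (L / 3 + 1),
      k ≤ (Finset.univ.filter fun w => (G.dist u w + 1) / 3 = j).card := by
    intro j hj
    obtain ⟨z, hz⟩ := hlevel (3 * j) (by have := Finset.mem_range.1 hj; omega)
    refine (hk z).trans (Finset.card_le_card fun w hw => ?_)
    simp only [Finset.mem_filter, Finset.mem_univ, true_and] at hw ⊢
    have h1 := hG.dist_triangle (u := u) (v := z) (w := w)
    have h2 := hG.dist_triangle (u := u) (v := w) (w := z)
    rw [G.dist_comm (u := w)] at h2
    omega
  have hsum : (L / 3 + 1) * k ≤ Fintype.card V := by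
    calc (L / 3 + 1) * k = ∑ _j ∈ Finset.range (L / 3 + 1), k := by simp
      _ ≤ ∑ j ∈ Finset.range (L / 3 + 1),
          (Finset.univ.filter fun w => (G.dist u w + 1) / 3 = j).card := Finset.sum_le_sum hfiber
      _ = (Finset.univ.filter fun w => (G.dist u w + 1) / 3 ∈ Finset.range (L / 3 + 1)).card := by
          rw [Finset.card_eq_sum_card_fiberwise (f := fun w => (G.dist u w + 1) / 3)
            (t := Finset.range (L / 3 + 1)) (by intro w hw; simpa using hw)]
          refine Finset.sum_congr rfl fun j hj => congrArg _ ?_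
          ext w
          simp only [Finset.mem_filter, Finset.mem_univ, true_and]
          exact ⟨fun h => ⟨h ▸ hj, h⟩, fun h => h.2⟩
      _ ≤ Fintype.card V := Finset.card_le_univ _
  calc (L + 1) * k ≤ (3 * (L / 3 + 1)) * k := Nat.mul_le_mul_right _ (by omega)
    _ = 3 * ((L / 3 + 1) * k) := by ring
    _ ≤ _ := Nat.mul_le_mul_left _ hsum

namespace DIProtocol

/-! ### Proximity graphs of point configurations -/

/-- The graph joining two distinct indices whose positions are at distance less than `r`. -/
def proximityGraph {ι X : Type*} [PseudoMetricSpace X] (p : ι → X) (r : ℝ) : SimpleGraph ι where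
  Adj a b := a ≠ b ∧ dist (p a) (p b) < r
  symm := ⟨fun _ _ h => ⟨h.1.symm, by rw [dist_comm]; exact h.2⟩⟩
  loopless := ⟨fun _ h => h.1 rfl⟩

theorem dist_le_mul_length {ι X : Type*} [PseudoMetricSpace X] {p : ι → X} {r : ℝ} {a b : ι}
    (w : (proximityGraph p r).Walk a b) : dist (p a) (p b) ≤ r * w.length := by
  induction w with
  | nil => simp
  | @cons a c b h w ih =>
    have hac : dist (p a) (p c) < r := And.right h
    rw [SimpleGraph.Walk.length_cons]
    push_cast
    linarith [dist_triangle (p a) (p c) (p b)]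

theorem proximityGraph_dist_le_one {ι X : Type*} [PseudoMetricSpace X] {p : ι → X} {r : ℝ}
    {a b : ι} (h : dist (p a) (p b) < r) : (proximityGraph p r).dist a b ≤ 1 := by
  by_cases hab : a = b
  · simp [hab]
  · have hadj : (proximityGraph p r).Adj a b := ⟨hab, h⟩
    exact (SimpleGraph.dist_eq_one_iff_adj.2 hadj).le

/-- If the union of the balls of radius `r / 2` is connected, so is the proximity graph. -/
theorem proximityGraph_connected {ι X : Type*} [PseudoMetricSpace X] {p : ι → X} {r : ℝ}
    (h : IsConnected (⋃ i, Metric.ball (p i) (r / 2))) : (proximityGraph p r).Connected := by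
  obtain ⟨y, hy⟩ := h.nonempty
  obtain ⟨i₀, hi₀⟩ := Set.mem_iUnion.1 hy
  have hr : 0 < r / 2 := Metric.pos_of_mem_ball hi₀
  refine (SimpleGraph.connected_iff _).2 ⟨fun a b => ?_, ⟨i₀⟩⟩
  by_contra hab
  set G := proximityGraph p r
  -- Balls of reachable and of unreachable indices would separate the union: a common point would
  -- give an edge between the two kinds.
  let U : Set X := ⋃ i ∈ {i | G.Reachable a i}, Metric.ball (p i) (r / 2)
  let W : Set X := ⋃ i ∈ {i | ¬ G.Reachable a i}, Metric.ball (p i) (r / 2)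
  have hU : IsOpen U := isOpen_biUnion fun i _ => Metric.isOpen_ball
  have hW : IsOpen W := isOpen_biUnion fun i _ => Metric.isOpen_ball
  have hcover : (⋃ i, Metric.ball (p i) (r / 2)) ⊆ U ∪ W := by
    refine Set.iUnion_subset fun i => ?_
    by_cases hi : G.Reachable a i
    · exact Set.subset_union_of_subset_left
        (Set.subset_biUnion_of_mem (u := fun i => Metric.ball (p i) (r / 2)) hi) _
    · exact Set.subset_union_of_subset_right
        (Set.subset_biUnion_of_mem (u := fun i => Metric.ball (p i) (r / 2)) hi) _
  obtain ⟨z, -, hzU, hzW⟩ := h.isPreconnected U W hU hW hcover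
    ⟨p a, Set.mem_iUnion.2 ⟨a, Metric.mem_ball_self hr⟩,
      Set.mem_biUnion (SimpleGraph.Reachable.refl a) (Metric.mem_ball_self hr)⟩
    ⟨p b, Set.mem_iUnion.2 ⟨b, Metric.mem_ball_self hr⟩,
      Set.mem_biUnion hab (Metric.mem_ball_self hr)⟩
  obtain ⟨i, hi, hzi⟩ := Set.mem_iUnion₂.1 hzU
  obtain ⟨j, hj, hzj⟩ := Set.mem_iUnion₂.1 hzW
  have hadj : G.Adj i j := by
    refine ⟨?_, ?_⟩
    · rintro rfl
      exact hj hi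
    · have := dist_triangle_left (p i) (p j) z
      rw [Metric.mem_ball] at hzi hzj
      linarith
  exact hj (SimpleGraph.Reachable.trans hi hadj.reachable)

/-! ### Geometry of a single configuration -/

section Configuration

variable {d N : ℕ} {κ δ : ℝ} {m : ℕ} {p : Fin N → Pos d} {A : Finset (Fin N)}

theorem mem_neighbors {i k : Fin N} :
    k ∈ neighbors δ m p i ↔ dist (p k) (p i) < δ ∧ m < (agentsInBall p δ i).card := by
  simp [neighbors]

theorem mem_agentsInBall {ρ : ℝ} {i k : Fin N} :
    k ∈ agentsInBall p ρ i ↔ dist (p k) (p i) < ρ := by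
  simp [agentsInBall]

theorem agentsInBall_subset {ρ : ℝ} (hρ : ρ ≤ δ) (i : Fin N) :
    agentsInBall p ρ i ⊆ agentsInBall p δ i := fun _ hk =>
  mem_agentsInBall.2 ((mem_agentsInBall.1 hk).trans_le hρ)

theorem neighbors_eq_agentsInBall {i : Fin N} (h : m < (agentsInBall p δ i).card) :
    neighbors δ m p i = agentsInBall p δ i := by
  ext k
  simp [mem_neighbors, mem_agentsInBall, h]

theorem IsIsolated.neighbors_subset (h : IsIsolated δ m p A) {i : Fin N} (hi : i ∈ A) :
    neighbors δ m p i ⊆ A := by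
  intro k hk
  by_contra hkA
  exact (h i hi k hkA).2 hk

/-- In an isolated cluster all of whose agents see each other, the neighbour sets coincide with
the cluster. -/
theorem IsIsolated.neighbors_eq (h : IsIsolated δ m p A) (hm : m < A.card)
    (hdiam : ∀ i ∈ A, ∀ j ∈ A, dist (p i) (p j) < δ) {i : Fin N} (hi : i ∈ A) :
    neighbors δ m p i = A := by
  have hsub : A ⊆ agentsInBall p δ i := fun k hk => mem_agentsInBall.2 (hdiam k hk i hi)
  have hcard := hm.trans_le (Finset.card_le_card hsub)
  refine (h.neighbors_subset hi).antisymm ?_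
  rwa [neighbors_eq_agentsInBall hcard]

/-- Both sums run over the same set `A`, so the `p k` cancel: each difference obeys its own linear
decay equation. -/
theorem velocity_sub_velocity (h : IsIsolated δ m p A) (hm : m < A.card)
    (hdiam : ∀ i ∈ A, ∀ j ∈ A, dist (p i) (p j) < δ) {i j : Fin N} (hi : i ∈ A) (hj : j ∈ A) :
    velocity κ δ m p i - velocity κ δ m p j = -(κ * A.card) • (p i - p j) := by
  rw [velocity, velocity, h.neighbors_eq hm hdiam hi, h.neighbors_eq hm hdiam hj, ← smul_sub,
    ← Finset.sum_sub_distrib]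
  simp only [sub_sub_sub_cancel_left, Finset.sum_const, ← Nat.cast_smul_eq_nsmul ℝ, smul_smul]
  rw [← neg_sub (p i), smul_neg, neg_smul]

/-- A cluster of more than `m` agents at mutual distance less than `δ` is densely packed. -/
theorem isDenselyPacked_of_dist_lt (hδ : 0 < δ) (hA : A.Nonempty) (hm : m < A.card)
    (hdiam : ∀ i ∈ A, ∀ j ∈ A, dist (p i) (p j) < δ) : IsDenselyPacked m δ p A := by
  refine ⟨?_, fun i hi => hm.trans_le (Finset.card_le_card fun k hk =>
    mem_agentsInBall.2 (hdiam k hk i hi))⟩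
  refine IsConnected.biUnion_of_reflTransGen (t := (A : Set (Fin N))) hA
    (fun i _ => ⟨⟨p i, Metric.mem_ball_self (half_pos hδ)⟩,
      (convex_ball (p i) (δ / 2)).isPreconnected⟩) fun i hi j hj => ?_
  refine Relation.ReflTransGen.single ⟨⟨midpoint ℝ (p i) (p j), ?_, ?_⟩, hi⟩
  · have := hdiam i hi j hj
    rw [Metric.mem_ball, dist_midpoint_left, Real.norm_ofNat]
    linarith
  · have := hdiam i hi j hj
    rw [Metric.mem_ball, dist_midpoint_right, Real.norm_ofNat]
    linarith

/-- In a densely packed isolated cluster the agents near a member belong to the cluster. -/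
theorem IsDenselyPacked.agentsInBall_subset_cluster {r : ℝ} (h : IsDenselyPacked m r p A)
    (hiso : IsIsolated δ m p A) (hr : r ≤ δ) {i : Fin N} (hi : i ∈ A) :
    agentsInBall p r i ⊆ A := by
  -- Having more than `m` agents in the smaller ball activates the `δ`-ball, whose agents are then
  -- all neighbours.
  have hsub := agentsInBall_subset (p := p) hr i
  have hcard := (h.2 i hi).trans_le (Finset.card_le_card hsub)
  rw [← neighbors_eq_agentsInBall hcard] at hsub
  exact hsub.trans (hiso.neighbors_subset hi)

theorem IsDenselyPacked.radius_pos {r : ℝ} (h : IsDenselyPacked m r p A) : 0 < r := by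
  obtain ⟨y, hy⟩ := h.1.nonempty
  obtain ⟨i, -, hy⟩ := Set.mem_iUnion₂.1 hy
  linarith [Metric.pos_of_mem_ball hy]

theorem IsDenselyPacked.lt_card {r : ℝ} (h : IsDenselyPacked m r p A)
    (hiso : IsIsolated δ m p A) (hr : r ≤ δ) (hA : A.Nonempty) : m < A.card := by
  obtain ⟨i, hi⟩ := hA
  exact (h.2 i hi).trans_le (Finset.card_le_card (h.agentsInBall_subset_cluster hiso hr hi))

/-- The diameter of an `r`-densely packed isolated cluster of `n` agents is at most
`(3 n / (m + 1) - 1) r`. -/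
theorem IsDenselyPacked.dist_add_le {r : ℝ} (h : IsDenselyPacked m r p A)
    (hiso : IsIsolated δ m p A) (hr : r ≤ δ) {i j : Fin N} (hi : i ∈ A) (hj : j ∈ A) :
    (dist (p i) (p j) + r) * (m + 1) ≤ 3 * A.card * r := by
  classical
  have hr0 := h.radius_pos
  let q : {a // a ∈ A} → Pos d := fun a => p a
  have hconn : (proximityGraph q r).Connected := by
    apply proximityGraph_connected
    have := h.1
    rwa [← Set.iUnion_subtype (fun a => a ∈ A) fun a => Metric.ball (p a) (r / 2)] at this
  have hdeg : ∀ a, m + 1 ≤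
      (Finset.univ.filter fun b => (proximityGraph q r).dist a b ≤ 1).card := by
    intro a
    refine (Nat.succ_le_of_lt (h.2 a a.2)).trans ?_
    rw [← Finset.card_map (Function.Embedding.subtype _)]
    refine Finset.card_le_card fun k hk => ?_
    have hkA := h.agentsInBall_subset_cluster hiso hr a.2 hk
    refine Finset.mem_map.2 ⟨⟨k, hkA⟩, ?_, rfl⟩
    simp only [Finset.mem_filter, Finset.mem_univ, true_and]
    apply proximityGraph_dist_le_one
    rw [dist_comm]
    exact mem_agentsInBall.1 hk
  have hbound := hconn.dist_add_one_mul_le hdeg ⟨i, hi⟩ ⟨j, hj⟩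
  obtain ⟨w, hw⟩ := hconn.exists_walk_length_eq_dist ⟨i, hi⟩ ⟨j, hj⟩
  have hdist : dist (p i) (p j) ≤ r * w.length := dist_le_mul_length w
  rw [← hw, Fintype.card_coe] at hbound
  have hbound' : ((w.length : ℝ) + 1) * (m + 1) ≤ 3 * A.card := by exact_mod_cast hbound
  calc (dist (p i) (p j) + r) * (m + 1) ≤ (r * w.length + r) * (m + 1) := by gcongr
    _ = ((w.length : ℝ) + 1) * (m + 1) * r := by ring
    _ ≤ 3 * A.card * r := by gcongr

end Configuration

/-! ### The smallness condition on the radius -/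

section Condition

theorem one_le_zConst (m n : ℕ) : 1 ≤ zConst m n := Real.one_le_exp (by positivity)

theorem zConst_lt_two {m n : ℕ} (hm : 0 < m) (hmn : m < n) : zConst m n < 2 := by
  have hn : (2 : ℝ) ≤ n := by exact_mod_cast (by omega : 2 ≤ n)
  have hmn' : (m : ℝ) ≤ n := by exact_mod_cast hmn.le
  rw [zConst, ← Real.lt_log_iff_exp_lt two_pos]
  refine lt_of_le_of_lt ?_ (lt_trans (by norm_num : (1 / 6 : ℝ) < 0.69) (by
    linarith [Real.log_two_gt_d9]))
  rw [div_le_iff₀ (by positivity)]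
  -- This is `4 m ≤ 4 n ≤ n ^ 3`, from `n (n - 2) (n + 2) ≥ 0`.
  nlinarith [mul_nonneg (sub_nonneg.2 hn) (by positivity : (0 : ℝ) ≤ n * (n + 2))]

theorem exists_packingCondition {δ : ℝ} (hδ : 0 < δ) {m n : ℕ} (hm : 0 < m) (hn : 0 < n) :
    ∃ r : ℝ, 0 < r ∧ r < δ ∧ PackingCondition δ m n r := by
  have hpos : (0 : ℝ) < m / (6 * n) := by positivity
  -- The bound `m / (6 n)` handles the linear factor; `1 / 2` keeps `r < δ` and the exponent of `Z`
  -- below `1`.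
  set ρ : ℝ := min (1 / 2) (m / (6 * n)) with hρ
  have hρ0 : 0 < ρ := lt_min (by norm_num) hpos
  have hρ1 : ρ ≤ 1 / 2 := min_le_left _ _
  refine ⟨ρ * δ, by positivity, by nlinarith, ?_⟩
  rw [PackingCondition, mul_div_cancel_right₀ _ hδ.ne']
  have hZ := one_le_zConst m n
  gcongr
  · exact min_le_right _ _
  · calc zConst m n ^ ρ ≤ zConst m n ^ (1 : ℝ) := Real.rpow_le_rpow_of_exponent_le hZ (by linarith)
      _ = zConst m n := Real.rpow_one _

/-- As `Z ^ (r / δ) ≥ 1` and `Z < 2`, the condition implies `r / δ < m / (3 n)`, all that is needed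
of it. -/
theorem PackingCondition.lt {δ r : ℝ} (hδ : 0 < δ) {m n : ℕ} (hm : 0 < m) (hmn : m < n)
    (hr : 0 < r) (h : PackingCondition δ m n r) : 3 * n * r < m * δ := by
  have hn : (0 : ℝ) < n := by exact_mod_cast hm.trans hmn
  have hm' : (0 : ℝ) < m := by exact_mod_cast hm
  have hρ : 0 < r / δ := div_pos hr hδ
  have h1 : r / δ ≤ m / (6 * n) * zConst m n := by
    refine le_trans ?_ h
    exact le_mul_of_one_le_right hρ.le (Real.one_le_rpow (one_le_zConst m n) hρ.le)
  have h2 : r / δ < m / (6 * n) * 2 :=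
    h1.trans_lt (mul_lt_mul_of_pos_left (zConst_lt_two hm hmn) (by positivity))
  rw [div_lt_iff₀ hδ] at h2
  calc 3 * n * r < 3 * n * (m / (6 * n) * 2 * δ) := by gcongr
    _ = m * δ := by field_simp; ring

end Condition

/-! ### Integrated equation and contraction of distances -/

section Dynamics

variable {d N : ℕ} {κ δ : ℝ} {m : ℕ} {x : ℝ → Fin N → Pos d}

theorem measurable_velocity (i : Fin N) :
    Measurable fun p : Fin N → Pos d => velocity κ δ m p i := by
  classical
  have hball : ∀ k, MeasurableSet {p : Fin N → Pos d | dist (p k) (p i) < δ} := fun k =>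
    (isOpen_lt (by fun_prop) continuous_const).measurableSet
  have hcard : Measurable fun p : Fin N → Pos d => (agentsInBall p δ i).card := by
    simp only [agentsInBall, Metric.mem_ball, Finset.card_filter]
    exact Finset.measurable_fun_sum _ fun k _ =>
      Measurable.ite (hball k) measurable_const measurable_const
  simp only [velocity, neighbors, Metric.mem_ball, Finset.sum_filter]
  refine Measurable.const_smul (Finset.measurable_fun_sum _ fun k _ => ?_) κ
  refine Measurable.ite ((hball k).inter (measurableSet_lt measurable_const hcard)) ?_
    measurable_const
  fun_prop

theorem norm_velocity_le (hδ : 0 ≤ δ) (p : Fin N → Pos d) (i : Fin N) :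
    ‖velocity κ δ m p i‖ ≤ |κ| * (N * δ) := by
  rw [velocity, norm_smul, Real.norm_eq_abs]
  gcongr
  calc ‖∑ k ∈ neighbors δ m p i, (p k - p i)‖ ≤ ∑ k ∈ neighbors δ m p i, ‖p k - p i‖ :=
        norm_sum_le _ _
    _ ≤ ∑ _k ∈ neighbors δ m p i, δ := Finset.sum_le_sum fun k hk => by
        rw [← dist_eq_norm]
        exact (mem_neighbors.1 hk).1.le
    _ = (neighbors δ m p i).card * δ := by simp
    _ ≤ N * δ := by
        gcongr
        simpa using Finset.card_le_univ (neighbors δ m p i)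

theorem intervalIntegrable_velocity (hδ : 0 ≤ δ) (hx : ContinuousOn x (Set.Ici 0)) (i : Fin N)
    {a b : ℝ} (ha : 0 ≤ a) (hb : 0 ≤ b) :
    IntervalIntegrable (fun s => velocity κ δ m (x s) i) volume a b := by
  -- `x` is uncontrolled at negative times, so it is frozen there at `x 0`.
  have hy : Continuous fun s => x (max s 0) :=
    hx.comp_continuous (by fun_prop) fun s => le_max_right s 0
  have hint : IntervalIntegrable (fun s => velocity κ δ m (x (max s 0)) i) volume a b :=
    (intervalIntegrable_const (c := |κ| * (N * δ))).mono_fun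
      ((measurable_velocity i).comp hy.measurable).aestronglyMeasurable
      (Filter.Eventually.of_forall fun s =>
        (norm_velocity_le hδ _ i).trans (le_abs_self _))
  refine hint.congr fun s hs => ?_
  have : 0 ≤ s := (le_min ha hb).trans hs.1.le
  simp [max_eq_left this]

theorem IsSolution.sub_eq_integral (hδ : 0 ≤ δ) (hx : IsSolution κ δ m x) (i : Fin N)
    {a b : ℝ} (ha : 0 ≤ a) (hb : 0 ≤ b) :
    x b i - x a i = ∫ s in a..b, velocity κ δ m (x s) i := by
  rw [hx.2 i b hb, hx.2 i a ha, add_sub_add_left_eq_sub]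
  exact intervalIntegral.integral_interval_sub_left
    (intervalIntegrable_velocity hδ hx.1 i le_rfl hb)
    (intervalIntegrable_velocity hδ hx.1 i le_rfl ha)

/-- A continuous curve solving `w' = -c w` in integrated form on `[a, b]`, with `c ≥ 0`, does not
increase in norm. -/
theorem norm_le_of_integral_eq {E : Type*} [NormedAddCommGroup E] [NormedSpace ℝ E]
    [CompleteSpace E] {w : ℝ → E} {a b c : ℝ} (hab : a ≤ b) (hc : 0 ≤ c)
    (hw : ContinuousOn w (Set.Icc a b))
    (h : ∀ t ∈ Set.Icc a b, w t = w a + ∫ s in a..t, -c • w s) : ‖w b‖ ≤ ‖w a‖ := by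
  let v : ℝ → E := Set.IccExtend hab ((Set.Icc a b).domRestrict w)
  have hv : Continuous v := hw.domRestrict.Icc_extend'
  have hvw : ∀ t ∈ Set.Icc a b, v t = w t := fun t ht => Set.IccExtend_of_mem hab _ ht
  have hwder : ∀ t ∈ Set.Icc a b, HasDerivWithinAt w (-c • w t) (Set.Icc a b) t := by
    intro t ht
    have h1 : HasDerivAt (fun t => w a + ∫ s in a..t, -c • v s) (-c • v t) t :=
      ((continuous_const.smul hv).integral_hasStrictDerivAt a t).hasDerivAt.const_add _
    rw [← hvw t ht]
    refine h1.hasDerivWithinAt.congr_of_mem (fun s hs => ?_) ht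
    rw [h s hs]
    congr 1
    refine intervalIntegral.integral_congr fun u hu => ?_
    rw [Set.uIcc_of_le hs.1] at hu
    simp only [hvw u ⟨hu.1, hu.2.trans hs.2⟩]
  -- Integrating factor: `exp (c t) w(t)` has zero derivative.
  have hconst : ∀ t ∈ Set.Icc a b, Real.exp (c * t) • w t = Real.exp (c * a) • w a := by
    have hder : ∀ t ∈ Set.Icc a b,
        HasDerivWithinAt (fun t => Real.exp (c * t) • w t) 0 (Set.Icc a b) t := by
      intro t ht
      have he : HasDerivAt (fun t => Real.exp (c * t)) (Real.exp (c * t) * (c * 1)) t :=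
        ((hasDerivAt_id t).const_mul c).exp
      have hsmul := he.hasDerivWithinAt.smul (hwder t ht)
      rw [smul_smul, ← add_smul,
        show Real.exp (c * t) * -c + Real.exp (c * t) * (c * 1) = 0 by ring, zero_smul] at hsmul
      exact hsmul
    refine constant_of_has_deriv_right_zero (fun t ht => (hder t ht).continuousWithinAt)
      fun t ht => ?_
    exact (hder t ⟨ht.1, ht.2.le⟩).mono_of_mem_nhdsWithin (Icc_mem_nhdsGE_of_mem ht)
  have hb := congrArg norm (hconst b (Set.right_mem_Icc.2 hab))
  rw [norm_smul, norm_smul, Real.norm_of_nonneg (Real.exp_pos _).le,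
    Real.norm_of_nonneg (Real.exp_pos _).le] at hb
  have hexp : Real.exp (c * a) ≤ Real.exp (c * b) := Real.exp_le_exp.2 (by gcongr)
  refine le_of_mul_le_mul_left ?_ (Real.exp_pos (c * b))
  rw [hb]
  gcongr

/-- As long as all agents of an isolated cluster see each other, their mutual distances do not
increase. -/
theorem IsSolution.dist_le {A : Finset (Fin N)} (hκ : 0 ≤ κ) (hδ : 0 ≤ δ)
    (hx : IsSolution κ δ m x) (hm : m < A.card) {a b : ℝ} (ha : 0 ≤ a) (hab : a ≤ b)
    (hiso : ∀ t ∈ Set.Ico a b, IsIsolated δ m (x t) A)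
    (hdiam : ∀ t ∈ Set.Ico a b, ∀ i ∈ A, ∀ j ∈ A, dist (x t i) (x t j) < δ)
    {i j : Fin N} (hi : i ∈ A) (hj : j ∈ A) :
    dist (x b i) (x b j) ≤ dist (x a i) (x a j) := by
  rw [dist_eq_norm, dist_eq_norm]
  have hcont : ∀ k, ContinuousOn (fun t => x t k) (Set.Icc a b) := fun k =>
    ((continuous_apply k).comp_continuousOn hx.1).mono fun t ht => ha.trans ht.1
  refine norm_le_of_integral_eq (w := fun t => x t i - x t j) (c := κ * A.card) hab
    (by positivity) ((hcont i).sub (hcont j)) fun t ht => ?_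
  have ht0 : 0 ≤ t := ha.trans ht.1
  have h1 := hx.sub_eq_integral hδ i ha ht0
  have h2 := hx.sub_eq_integral hδ j ha ht0
  have h3 : ∫ s in a..t, -(κ * A.card) • (x s i - x s j)
      = (x t i - x a i) - (x t j - x a j) := by
    rw [h1, h2, ← intervalIntegral.integral_sub
      (intervalIntegrable_velocity hδ hx.1 i ha ht0) (intervalIntegrable_velocity hδ hx.1 j ha ht0)]
    -- The endpoint `b` is excluded: there the distances may reach `δ`, as at a first exit time.
    refine intervalIntegral.integral_congr_Ioo_of_le ht.1 fun s hs => ?_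
    have hs' : s ∈ Set.Ico a b := ⟨hs.1.le, hs.2.trans_le ht.2⟩
    exact (velocity_sub_velocity (hiso s hs') hm (hdiam s hs') hi hj).symm
  simp only [h3]
  abel

/-- An isolated cluster of diameter less than `δ` and more than `m` agents keeps these mutual
distances below `δ` forever. -/
theorem IsSolution.dist_lt {A : Finset (Fin N)} (hκ : 0 ≤ κ) (hδ : 0 ≤ δ)
    (hx : IsSolution κ δ m x) (hm : m < A.card) {t₀ : ℝ} (ht₀ : 0 ≤ t₀)
    (hiso : ∀ t, t₀ ≤ t → IsIsolated δ m (x t) A)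
    (hdiam : ∀ i ∈ A, ∀ j ∈ A, dist (x t₀ i) (x t₀ j) < δ) {t : ℝ} (ht : t₀ ≤ t) :
    ∀ i ∈ A, ∀ j ∈ A, dist (x t i) (x t j) < δ := by
  by_contra! hcon
  let S : Set ℝ := ⋃ i ∈ A, ⋃ j ∈ A, Set.Ici t₀ ∩ (fun s => dist (x s i) (x s j)) ⁻¹' Set.Ici δ
  have hS : ∀ s, s ∈ S ↔ t₀ ≤ s ∧ ∃ i ∈ A, ∃ j ∈ A, δ ≤ dist (x s i) (x s j) := by
    intro s
    simp only [S, Set.mem_iUnion, Set.mem_inter_iff, Set.mem_Ici, Set.mem_preimage, exists_prop]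
    exact ⟨fun ⟨i, hi, j, hj, hs, hd⟩ => ⟨hs, i, hi, j, hj, hd⟩,
      fun ⟨hs, i, hi, j, hj, hd⟩ => ⟨i, hi, j, hj, hs, hd⟩⟩
  have hcont : ∀ k, ContinuousOn (fun t => x t k) (Set.Ici t₀) := fun k =>
    ((continuous_apply k).comp_continuousOn hx.1).mono fun t ht => ht₀.trans ht
  have hclosed : IsClosed S := A.finite_toSet.isClosed_biUnion fun i _ =>
    A.finite_toSet.isClosed_biUnion fun j _ =>
      (continuous_dist.comp_continuousOn ((hcont i).prodMk (hcont j))).preimage_isClosed_of_isClosed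
        isClosed_Ici isClosed_Ici
  have hbdd : BddBelow S := ⟨t₀, fun s hs => ((hS s).1 hs).1⟩
  have hmem : sInf S ∈ S := hclosed.csInf_mem ⟨t, (hS t).2 ⟨ht, hcon⟩⟩ hbdd
  obtain ⟨hle, i, hi, j, hj, hij⟩ := (hS _).1 hmem
  -- Before the first exit time `sInf S` all members see each other, so no distance can have grown
  -- to `δ`.
  refine absurd (hij.trans (hx.dist_le hκ hδ hm ht₀ hle (fun s hs => hiso s hs.1)
    (fun s hs k hk l hl => ?_) hi hj)) (hdiam i hi j hj).not_ge
  by_contra! hkl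
  exact (notMem_of_lt_csInf hs.2 hbdd) ((hS s).2 ⟨hs.1, k, hk, l, hl, hkl⟩)

end Dynamics

end DIProtocol

theorem lemma2 {d N : ℕ} (κ δ : ℝ) (hκ : 0 < κ) (hδ : 0 < δ) (m : ℕ) (hm : 0 < m)
    (A : Finset (Fin N)) (hA : A.Nonempty) :
    (∃ rstar : ℝ, 0 < rstar ∧ rstar < δ ∧ DIProtocol.PackingCondition δ m A.card rstar) ∧
    ∀ rstar : ℝ, 0 < rstar → rstar < δ → DIProtocol.PackingCondition δ m A.card rstar →
      ∀ x : ℝ → Fin N → DIProtocol.Pos d, DIProtocol.IsSolution κ δ m x →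
      ∀ t₀ : ℝ, 0 ≤ t₀ →
        (∀ t : ℝ, t₀ ≤ t → DIProtocol.IsIsolated δ m (x t) A) →
        ∀ r : ℝ, r ≤ rstar → DIProtocol.IsDenselyPacked m r (x t₀) A →
          ∀ t : ℝ, t₀ ≤ t → DIProtocol.IsDenselyPacked m δ (x t) A := by
  refine ⟨DIProtocol.exists_packingCondition hδ hm hA.card_pos, ?_⟩
  intro rstar hpos hlt hcond x hx t₀ ht₀ hiso r hr hdense t ht
  have hrδ : r ≤ δ := hr.trans hlt.le
  have hcard := hdense.lt_card (hiso t₀ le_rfl) hrδ hA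
  refine DIProtocol.isDenselyPacked_of_dist_lt hδ hA hcard
    (hx.dist_lt hκ.le hδ.le hcard ht₀ hiso (fun i hi j hj => ?_) ht)
  have h1 := hdense.dist_add_le (hiso t₀ le_rfl) hrδ hi hj
  have h2 : 3 * (A.card : ℝ) * r ≤ 3 * A.card * rstar := by gcongr
  have h3 := hcond.lt hδ hm hcard hpos
  have hr0 := hdense.radius_pos
  have hm' : (0 : ℝ) ≤ m := m.cast_nonneg
  by_contra! hge
  -- A distance `D ≥ δ` would give `m δ ≤ (D + r) (m + 1) ≤ 3 n rstar < m δ`.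
  nlinarith [mul_le_mul_of_nonneg_right hge hm', mul_nonneg hr0.le hm']
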